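/- Strong maximum principle. Let $n\ge 1$. For a real symmetric $n\times n$ matrix $X$ let $\lambda_1(X)\le\dots\le\lambda_n(X)$ be its eigenvalues counted with multiplicity. For ${\bf a}=(a_1,\dots,a_n)\in\mathbb R^n$ with $a_i\ge 0$ for all $i$ put $\mathcal M_{\bf a}(X)=\sum_{i=1}^n a_i\lambda_i(X)$. Let $\Omega\subset\mathbb R^n$ be a domain, i.e. a nonempty connected open set. A continuous function $u:\Omega\to\mathbb R$ is called a viscosity supersolution (resp. subsolution) of $\mathcal M_{\bf a}(D^2u)=0$ in $\Omega$ if $\mathcal M_{\bf a}(X)\le 0$ (resp. $\mathcal M_{\bf a}(X)\ge 0$) for every $x_0\in\Omega$, every $\xi\in\mathbb R^n$ and every real symmetric $n\times n$ matrix $X$ for which $$u(x)\ \ge\ u(x_0)+\langle\xi,x-x_0\rangle+\tfrac12\langle X(x-x_0),x-x_0\rangle+o(|x-x_0|^2)\quad\text{as } x\to x_0$$ (resp. the same with $\le$ in place of $\ge$). (i) Suppose $a_n>0$, and let $u$ be a non-negative continuous viscosity supersolution of $\mathcal M_{\bf a}(D^2u)=0$ in $\Omega$. If $u$ attains its minimum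 $m$ over $\Omega$ at some point $x_0\in\Omega$, then $u\equiv m$ in $\Omega$. (ii) Suppose $a_1>0$, and let $u$ be a continuous viscosity subsolution of $\mathcal M_{\bf a}(D^2u)=0$ in $\Omega$. If $u$ attains its maximum $M$ over $\Omega$ at some point $x_0\in\Omega$, then $u\equiv M$ in $\Omega$. -/

import Mathlib

open Filter Topology Asymptotics

noncomputable section

/-- The set `S^n` of real symmetric `n × n` matrices. -/
abbrev SymMat (n : ℕ) : Type := {X : Matrix (Fin n) (Fin n) ℝ // X.IsSymm}

theorem SymMat.isHermitian {n : ℕ} (X : SymMat n) : X.1.IsHermitian := by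
  rw [Matrix.IsHermitian, Matrix.conjTranspose_eq_transpose_of_trivial]
  exact X.2

/-- The eigenvalues `λ_1(X) ≤ ... ≤ λ_n(X)` of a symmetric matrix, counted with multiplicity, in
increasing order; the index `i : Fin n` is the mathematical index minus one. (Mathlib's
`eigenvalues₀` lists them in decreasing order.) -/
def SymMat.eig {n : ℕ} (X : SymMat n) (i : Fin n) : ℝ :=
  X.isHermitian.eigenvalues₀ (Fin.cast (Fintype.card_fin n).symm i.rev)

theorem SymMat.eig_monotone {n : ℕ} (X : SymMat n) : Monotone X.eig := by
  intro i j hij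
  refine X.isHermitian.eigenvalues₀_antitone ?_
  have h : j.rev ≤ i.rev := Fin.rev_le_rev.mpr hij
  exact h

theorem SymMat.roots_charpoly_eq_eig {n : ℕ} (X : SymMat n) :
    X.1.charpoly.roots = Multiset.map X.eig Finset.univ.val := by
  rw [X.isHermitian.roots_charpoly_eq_eigenvalues₀]
  have key : Finset.univ.val = Multiset.map
      (fun i : Fin n => Fin.cast (Fintype.card_fin n).symm i.rev) Finset.univ.val := by
    have := Finset.map_univ_equiv
      (Fin.revPerm.trans (finCongr (Fintype.card_fin n).symm))
    rw [← this]
    rfl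
  rw [key, Multiset.map_map]
  rfl

/-- The weighted partial trace operator `M_a(X) = a_1 λ_1(X) + ... + a_n λ_n(X)`. -/
def weightedPartialTrace {n : ℕ} (a : Fin n → ℝ) (X : SymMat n) : ℝ :=
  ∑ i, a i * X.eig i

/-- The quadratic polynomial `u(x₀) + ⟨ξ, x - x₀⟩ + ½ ⟨X (x - x₀), x - x₀⟩`. -/
def jetPolynomial {n : ℕ} (u : EuclideanSpace ℝ (Fin n) → ℝ) (x₀ ξ : EuclideanSpace ℝ (Fin n))
    (X : SymMat n) (x : EuclideanSpace ℝ (Fin n)) : ℝ :=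
  u x₀ + inner ℝ ξ (x - x₀) + 1 / 2 * inner ℝ (Matrix.toEuclideanLin X.1 (x - x₀)) (x - x₀)

/-- The second order superjet `J^{2,+}_O u(x₀)`: the pairs `(ξ, X)` such that
`u(x) ≤ u(x₀) + ⟨ξ, x - x₀⟩ + ½ ⟨X (x - x₀), x - x₀⟩ + o(|x - x₀|²)` as `x → x₀` in `O`. -/
def superjet {n : ℕ} (O : Set (EuclideanSpace ℝ (Fin n))) (u : EuclideanSpace ℝ (Fin n) → ℝ)
    (x₀ : EuclideanSpace ℝ (Fin n)) : Set (EuclideanSpace ℝ (Fin n) × SymMat n) :=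
  {p | ∃ r : EuclideanSpace ℝ (Fin n) → ℝ,
    r =o[𝓝[O] x₀] (fun x => ‖x - x₀‖ ^ 2) ∧
      ∀ᶠ x in 𝓝[O] x₀, u x ≤ jetPolynomial u x₀ p.1 p.2 x + r x}

/-- The second order subjet `J^{2,-}_O u(x₀)`: the pairs `(ξ, X)` such that
`u(x) ≥ u(x₀) + ⟨ξ, x - x₀⟩ + ½ ⟨X (x - x₀), x - x₀⟩ + o(|x - x₀|²)` as `x → x₀` in `O`. -/
def subjet {n : ℕ} (O : Set (EuclideanSpace ℝ (Fin n))) (u : EuclideanSpace ℝ (Fin n) → ℝ)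
    (x₀ : EuclideanSpace ℝ (Fin n)) : Set (EuclideanSpace ℝ (Fin n) × SymMat n) :=
  {p | ∃ r : EuclideanSpace ℝ (Fin n) → ℝ,
    r =o[𝓝[O] x₀] (fun x => ‖x - x₀‖ ^ 2) ∧
      ∀ᶠ x in 𝓝[O] x₀, jetPolynomial u x₀ p.1 p.2 x + r x ≤ u x}

/-- `u` is a viscosity subsolution of `F(D²u) = f` in `O`. -/
def IsViscositySubsolution {n : ℕ} (F : SymMat n → ℝ) (f : EuclideanSpace ℝ (Fin n) → ℝ)
    (O : Set (EuclideanSpace ℝ (Fin n))) (u : EuclideanSpace ℝ (Fin n) → ℝ) : Prop :=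
  UpperSemicontinuousOn u O ∧ ∀ x ∈ O, ∀ p ∈ superjet O u x, f x ≤ F p.2

/-- `u` is a viscosity supersolution of `F(D²u) = f` in `O`. -/
def IsViscositySupersolution {n : ℕ} (F : SymMat n → ℝ) (f : EuclideanSpace ℝ (Fin n) → ℝ)
    (O : Set (EuclideanSpace ℝ (Fin n))) (u : EuclideanSpace ℝ (Fin n) → ℝ) : Prop :=
  LowerSemicontinuousOn u O ∧ ∀ x ∈ O, ∀ p ∈ subjet O u x, F p.2 ≤ f x

end

/-!
The set where a supersolution `u` equals its minimum is relatively closed in `Ω`. If it is not all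
of `Ω`, some ball meets it in exactly one point `z`, on the boundary of the ball. Perturb `u` near
`z` by a small multiple `ε` of a radial barrier that decreases away from the center of the ball: on
a small sphere around `z` the barrier exceeds its value at `z` only where `u` is strictly above its
minimum, so `u - ε • barrier` has an interior minimum, where the Hessian of `ε • barrier` lies in
the subjet of `u`. That Hessian is a large rank-one matrix `d p pᵀ` minus a small multiple of the
identity. Since `λ_n` sees the rank-one part and the other eigenvalues are at worst slightly
negative, `a_n > 0` makes `M_a` positive on it, which a supersolution forbids.

Subsolutions reduce to supersolutions because `λ_i(-X) = -λ_{n+1-i}(X)`: replacing `u` by `-u`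
turns `M_a` into `M_b` with `b` the reversal of `a`.
-/

open Metric

section StrictPerturbation

variable {X : Type*} [TopologicalSpace X] {C S : Set X} {u w : X → ℝ} {z : X}

theorem exists_pos_mul_sub_le_sub (hC : IsCompact C) (hS : IsClosed S)
    (hu : LowerSemicontinuousOn u C) (hw : ContinuousOn w C) (hmin : IsMinOn u C z)
    (hlt : ∀ x ∈ C ∩ S, w z ≤ w x → u z < u x) :
    ∃ ε > 0, ∀ x ∈ C ∩ S, ε * (w x - w z) ≤ u x - u z := by
  obtain ⟨v, hv, hwv⟩ := continuousOn_iff_isClosed.1 hw (Set.Ici (w z)) isClosed_Ici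
  have mem_v {x} (hx : x ∈ C) : x ∈ v ↔ w z ≤ w x := by
    simpa [hx] using (Set.ext_iff.1 hwv x).symm
  obtain ⟨η, hη, hηle⟩ : ∃ η > 0, ∀ x ∈ C ∩ (S ∩ v), η ≤ u x - u z := by
    rcases (C ∩ (S ∩ v)).eq_empty_or_nonempty with hempty | hne
    · exact ⟨1, one_pos, by simp [hempty]⟩
    · obtain ⟨x', ⟨hx'C, hx'S, hx'v⟩, hx'min⟩ := (hu.mono Set.inter_subset_left).exists_isMinOn hne
        (hC.inter_right (hS.inter hv))
      exact ⟨u x' - u z, sub_pos.2 (hlt x' ⟨hx'C, hx'S⟩ ((mem_v hx'C).1 hx'v)),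
        fun x hx => sub_le_sub_right (hx'min hx) _⟩
  obtain ⟨W, hW⟩ := hC.bddAbove_image hw
  obtain ⟨ε, hε, hεη⟩ := exists_pos_mul_lt hη (W - w z)
  refine ⟨ε, hε, fun x ⟨hxC, hxS⟩ => ?_⟩
  rcases le_total (w x) (w z) with hxz | hxz
  · have : u z ≤ u x := hmin hxC
    nlinarith
  · have : w x ≤ W := hW (Set.mem_image_of_mem w hxC)
    have := hηle x ⟨hxC, hxS, (mem_v hxC).2 hxz⟩
    nlinarith

theorem exists_isMinOn_sub_mul_of_lt (hC : IsCompact C) (hS : IsClosed S)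
    (hu : LowerSemicontinuousOn u C) (hw : ContinuousOn w C) (hz : z ∈ C \ S)
    (hmin : IsMinOn u C z) (hlt : ∀ x ∈ C ∩ S, w z ≤ w x → u z < u x) :
    ∃ ε > 0, ∃ x₁ ∈ C \ S, IsMinOn (fun x => u x - ε * w x) C x₁ := by
  obtain ⟨ε, hε, hle⟩ := exists_pos_mul_sub_le_sub hC hS hu hw hmin hlt
  have hlsc : LowerSemicontinuousOn (fun x => u x - ε * w x) C := by
    simp only [sub_eq_add_neg]
    exact hu.add (hw.const_smul ε).neg.lowerSemicontinuousOn
  obtain ⟨x₁, hx₁, hx₁min⟩ := hlsc.exists_isMinOn ⟨z, hz.1⟩ hC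
  by_cases hx₁S : x₁ ∈ S
  · have hzx₁ : u z - ε * w z ≤ u x₁ - ε * w x₁ := by linarith [hle x₁ ⟨hx₁, hx₁S⟩]
    exact ⟨ε, hε, z, hz, fun x hx => hzx₁.trans (hx₁min hx)⟩
  · exact ⟨ε, hε, x₁, ⟨hx₁, hx₁S⟩, hx₁min⟩

end StrictPerturbation

section TouchingBall

variable {E : Type*} [NormedAddCommGroup E] [NormedSpace ℝ E] [StrictConvexSpace ℝ E]

theorem dist_lt_of_mem_closedBall_midpoint {x y z : E}
    (hx : x ∈ closedBall (midpoint ℝ y z) (dist z (midpoint ℝ y z))) (hxz : x ≠ z) :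
    dist x y < dist z y := by
  set c := midpoint ℝ y z with hc
  have hcy : c - y = z - c := by rw [hc, midpoint_sub_left, right_sub_midpoint]
  have hzy : dist z y = dist z c + dist z c := by
    rw [dist_right_midpoint, dist_comm y z, Real.norm_two]
    ring
  have hle : ‖x - c‖ ≤ ‖z - c‖ := by simpa only [mem_closedBall, dist_eq_norm] using hx
  rw [hzy]
  by_contra! hge
  simp only [dist_eq_norm] at hge
  have hsplit : x - y = (x - c) + (z - c) := by rw [← hcy]; abel
  have htri := norm_add_le (x - c) (z - c)
  rw [hsplit] at hge
  have heq : x - c = z - c :=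
    eq_of_norm_eq_of_norm_add_eq (by linarith) (by linarith)
  exact hxz (sub_left_injective heq)

variable [ProperSpace E] {A Ω : Set E}

theorem exists_closedBall_inter_eq_singleton_of_notMem_nhds {x₀ : E} (hΩ : Ω ∈ 𝓝 x₀)
    (hA : closure A ∩ Ω ⊆ A) (hx₀ : x₀ ∈ A) (hA₀ : A ∉ 𝓝 x₀) :
    ∃ z ∈ A, ∃ y ≠ z, closedBall y (dist z y) ∩ A = {z} := by
  obtain ⟨r, hr, hrΩ⟩ := nhds_basis_closedBall.mem_iff.1 hΩ
  obtain ⟨y₀, hy₀, hy₀A⟩ : ∃ y₀ ∈ ball x₀ (r / 2), y₀ ∉ A :=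
    Set.not_subset.1 fun h => hA₀ (mem_of_superset (ball_mem_nhds x₀ (half_pos hr)) h)
  have hK : IsCompact (closedBall x₀ r ∩ A) := by
    have : closedBall x₀ r ∩ A = closedBall x₀ r ∩ closure A :=
      (Set.inter_subset_inter_right _ subset_closure).antisymm
        fun x hx => ⟨hx.1, hA ⟨hx.2, hrΩ hx.1⟩⟩
    exact this ▸ (isCompact_closedBall x₀ r).inter_right isClosed_closure
  obtain ⟨z, ⟨-, hzA⟩, hz⟩ := hK.exists_infDist_eq_dist ⟨x₀, mem_closedBall_self hr.le, hx₀⟩ y₀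
  have hnearest {x} (hx : x ∈ closedBall x₀ r) (hxA : x ∈ A) : dist z y₀ ≤ dist x y₀ := by
    simpa only [hz, dist_comm y₀] using infDist_le_dist_of_mem (x := y₀) (Set.mem_inter hx hxA)
  have hzy₀ : z ≠ y₀ := fun h => hy₀A (h ▸ hzA)
  refine ⟨z, hzA, midpoint ℝ y₀ z, by simpa using hzy₀.symm, ?_⟩
  refine Set.eq_singleton_iff_unique_mem.2 ⟨⟨mem_closedBall.2 le_rfl, hzA⟩, ?_⟩
  rintro x ⟨hx, hxA⟩
  by_contra hxz
  have hlt : dist x y₀ < dist z y₀ := dist_lt_of_mem_closedBall_midpoint hx hxz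
  have hzx₀ : dist z y₀ ≤ dist y₀ x₀ := by
    simpa only [dist_comm x₀] using hnearest (mem_closedBall_self hr.le) hx₀
  rw [mem_ball] at hy₀
  exact (hnearest (by rw [mem_closedBall]; linarith [dist_triangle x y₀ x₀]) hxA).not_gt hlt

theorem exists_closedBall_inter_eq_singleton (hΩ : IsOpen Ω) (hΩc : IsPreconnected Ω)
    (hAΩ : A ⊆ Ω) (hA : closure A ∩ Ω ⊆ A) (hne : A.Nonempty) (hΩA : ¬ Ω ⊆ A) :
    ∃ z ∈ A, ∃ y ≠ z, closedBall y (dist z y) ∩ A = {z} := by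
  have hnotOpen : ¬ IsOpen A := fun hopen =>
    hΩA (hΩc.subset_of_closure_inter_subset hopen
      (by rwa [Set.inter_eq_right.2 hAΩ]) hA)
  obtain ⟨x₀, hx₀, hA₀⟩ : ∃ x₀ ∈ A, A ∉ 𝓝 x₀ := by
    simpa only [isOpen_iff_mem_nhds, not_forall, exists_prop] using hnotOpen
  exact exists_closedBall_inter_eq_singleton_of_notMem_nhds (hΩ.mem_nhds (hAΩ hx₀)) hA hx₀ hA₀

end TouchingBall

namespace SymMat

variable {n : ℕ}

theorem spectrum_eq_range_eig (X : SymMat n) : spectrum ℝ X.1 = Set.range X.eig := by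
  ext t
  rw [Matrix.mem_spectrum_iff_isRoot_charpoly, ← Polynomial.mem_roots X.1.charpoly_monic.ne_zero,
    X.roots_charpoly_eq_eig]
  simp

theorem hasEigenvalue_iff_mem_range_eig (X : SymMat n) {t : ℝ} :
    Module.End.HasEigenvalue (Matrix.toEuclideanLin X.1) t ↔ t ∈ Set.range X.eig := by
  rw [Module.End.hasEigenvalue_iff_mem_spectrum, Matrix.spectrum_toLpLin, X.spectrum_eq_range_eig]

theorem le_eig_of_forall_le_inner {X : SymMat n} {c : ℝ}
    (h : ∀ v, c * ‖v‖ ^ 2 ≤ inner ℝ (Matrix.toEuclideanLin X.1 v) v) (i : Fin n) :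
    c ≤ X.eig i := by
  obtain ⟨v, hv⟩ := (X.hasEigenvalue_iff_mem_range_eig.2 ⟨i, rfl⟩).exists_hasEigenvector
  have hcv := h v
  rw [hv.apply_eq_smul, real_inner_smul_left, real_inner_self_eq_norm_sq] at hcv
  exact le_of_mul_le_mul_right hcv (pow_pos (norm_pos_iff.2 hv.2) 2)

theorem le_eig_of_hasEigenvalue {X : SymMat n} {t : ℝ}
    (h : Module.End.HasEigenvalue (Matrix.toEuclideanLin X.1) t) {j : Fin n} (hj : IsTop j) :
    t ≤ X.eig j := by
  obtain ⟨i, rfl⟩ := X.hasEigenvalue_iff_mem_range_eig.1 h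
  exact X.eig_monotone (hj i)

theorem eig_eq_of_monotone {X : SymMat n} {f : Fin n → ℝ} (hf : Monotone f)
    (h : X.1.charpoly = ∏ i, (Polynomial.X - Polynomial.C (f i))) : X.eig = f := by
  have hroots : X.1.charpoly.roots = Multiset.map f Finset.univ.val := by
    rw [h, Polynomial.roots_prod _ _
      (Finset.prod_ne_zero_iff.2 fun i _ => Polynomial.X_sub_C_ne_zero _)]
    simp
  rw [X.roots_charpoly_eq_eig, Fin.univ_val_map, Fin.univ_val_map, Multiset.coe_eq_coe] at hroots
  exact List.ofFn_injective (hroots.eq_of_sortedLE X.eig_monotone.sortedLE_ofFn hf.sortedLE_ofFn)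

theorem eval_charpoly_eq_prod_sub_eig (X : SymMat n) (t : ℝ) :
    X.1.charpoly.eval t = ∏ i, (t - X.eig i) := by
  rw [X.isHermitian.splits_charpoly.eval_eq_prod_roots_of_monic X.1.charpoly_monic,
    X.roots_charpoly_eq_eig, Multiset.map_map]
  rfl

instance : Neg (SymMat n) :=
  ⟨fun X => ⟨-X.1, X.2.neg⟩⟩

theorem charpoly_neg (X : SymMat n) :
    (-X).1.charpoly = ∏ i, (Polynomial.X - Polynomial.C (-X.eig i)) := by
  refine Polynomial.funext fun t => ?_
  calc (-X).1.charpoly.eval t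
      = (-(Matrix.scalar (Fin n) (-t) - X.1)).det := by
        rw [Matrix.eval_charpoly, map_neg, neg_sub, sub_neg_eq_add, add_comm]
        exact congrArg Matrix.det (sub_neg_eq_add _ _)
    _ = (-1) ^ n * ∏ i, (-t - X.eig i) := by
        rw [Matrix.det_neg, Fintype.card_fin, ← Matrix.eval_charpoly,
          X.eval_charpoly_eq_prod_sub_eig]
    _ = ∏ i, (t - -X.eig i) := by
        have hfactor (i : Fin n) : t - -X.eig i = -1 * (-t - X.eig i) := by ring
        simp only [hfactor, Finset.prod_mul_distrib, Finset.prod_const, Finset.card_univ,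
          Fintype.card_fin]
    _ = _ := by
        simp only [Polynomial.eval_prod, Polynomial.eval_sub, Polynomial.eval_X, Polynomial.eval_C]

theorem eig_neg (X : SymMat n) (i : Fin n) : (-X).eig i = -X.eig i.rev := by
  have hmono : Monotone fun i : Fin n => -X.eig i.rev := fun i j hij =>
    neg_le_neg (X.eig_monotone (Fin.rev_le_rev.2 hij))
  refine congrFun (eig_eq_of_monotone hmono ?_) i
  rw [X.charpoly_neg]
  exact (Equiv.prod_comp Fin.revPerm fun i => Polynomial.X - Polynomial.C (-X.eig i)).symm

/-- The matrix `d p pᵀ - c I`, which is the shape of the Hessian at distance `‖p‖` from the center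
of a radial function. -/
def rankOneSubScalar (d c : ℝ) (p : EuclideanSpace ℝ (Fin n)) : SymMat n :=
  ⟨d • Matrix.vecMulVec p.ofLp p.ofLp - c • 1, by
    rw [Matrix.IsSymm, Matrix.transpose_sub, Matrix.transpose_smul, Matrix.transpose_vecMulVec,
      Matrix.transpose_smul, Matrix.transpose_one]⟩

theorem toEuclideanLin_rankOneSubScalar (d c : ℝ) (p v : EuclideanSpace ℝ (Fin n)) :
    Matrix.toEuclideanLin (rankOneSubScalar d c p).1 v = (d * inner ℝ p v) • p - c • v := by
  ext i
  simp only [rankOneSubScalar, Matrix.toLpLin_apply, Matrix.sub_mulVec, Matrix.smul_mulVec,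
    Matrix.one_mulVec, Matrix.vecMulVec_mulVec, PiLp.sub_apply, PiLp.smul_apply, Pi.sub_apply,
    Pi.smul_apply, smul_eq_mul, EuclideanSpace.inner_eq_star_dotProduct, star_trivial,
    MulOpposite.smul_eq_mul_unop, MulOpposite.unop_op, dotProduct_comm v.ofLp]
  ring

theorem inner_toEuclideanLin_rankOneSubScalar (d c : ℝ) (p v : EuclideanSpace ℝ (Fin n)) :
    inner ℝ (Matrix.toEuclideanLin (rankOneSubScalar d c p).1 v) v =
      d * inner ℝ p v ^ 2 - c * ‖v‖ ^ 2 := by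
  rw [toEuclideanLin_rankOneSubScalar, inner_sub_left, real_inner_smul_left, real_inner_smul_left,
    real_inner_self_eq_norm_sq]
  ring

theorem hasEigenvalue_rankOneSubScalar (d c : ℝ) {p : EuclideanSpace ℝ (Fin n)} (hp : p ≠ 0) :
    Module.End.HasEigenvalue (Matrix.toEuclideanLin (rankOneSubScalar d c p).1)
      (d * ‖p‖ ^ 2 - c) := by
  refine Module.End.hasEigenvalue_of_hasEigenvector (x := p)
    ⟨Module.End.mem_eigenspace_iff.2 ?_, hp⟩
  rw [toEuclideanLin_rankOneSubScalar, real_inner_self_eq_norm_sq, sub_smul]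

end SymMat

section WeightedPartialTrace

variable {n : ℕ} {a : Fin n → ℝ}

theorem le_weightedPartialTrace_rankOneSubScalar (ha : ∀ i, 0 ≤ a i) {d : ℝ} (hd : 0 ≤ d) (c : ℝ)
    {p : EuclideanSpace ℝ (Fin n)} (hp : p ≠ 0) {j : Fin n} (hj : IsTop j) :
    d * ‖p‖ ^ 2 * a j - c * ∑ i, a i ≤ weightedPartialTrace a (.rankOneSubScalar d c p) := by
  set X := SymMat.rankOneSubScalar d c p with hX
  have hall (i : Fin n) : -c ≤ X.eig i := SymMat.le_eig_of_forall_le_inner (fun v => by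
    rw [hX, SymMat.inner_toEuclideanLin_rankOneSubScalar]
    nlinarith [mul_nonneg hd (sq_nonneg (inner ℝ p v))]) i
  have htop : d * ‖p‖ ^ 2 - c ≤ X.eig j :=
    SymMat.le_eig_of_hasEigenvalue (SymMat.hasEigenvalue_rankOneSubScalar d c hp) hj
  calc d * ‖p‖ ^ 2 * a j - c * ∑ i, a i
      ≤ a j * (X.eig j + c) - c * ∑ i, a i := by nlinarith [ha j]
    _ ≤ ∑ i, a i * (X.eig i + c) - c * ∑ i, a i := sub_le_sub_right
        (Finset.single_le_sum (f := fun i => a i * (X.eig i + c))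
          (fun i _ => mul_nonneg (ha i) (by linarith [hall i])) (Finset.mem_univ j)) _
    _ = weightedPartialTrace a X := by
        simp only [weightedPartialTrace, mul_add, Finset.sum_add_distrib, ← Finset.sum_mul]
        ring

theorem weightedPartialTrace_rankOneSubScalar_pos (ha : ∀ i, 0 ≤ a i) {j : Fin n} (hj : IsTop j)
    (haj : 0 < a j) {d c : ℝ} {p : EuclideanSpace ℝ (Fin n)} (hc : 0 ≤ c)
    (hcd : (∑ i, a i) / a j * c < d * ‖p‖ ^ 2) :
    0 < weightedPartialTrace a (.rankOneSubScalar d c p) := by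
  have hdp : 0 < d * ‖p‖ ^ 2 :=
    (mul_nonneg (div_nonneg (Finset.sum_nonneg fun i _ => ha i) haj.le) hc).trans_lt hcd
  have hd : 0 ≤ d := (pos_of_mul_pos_left hdp (sq_nonneg _)).le
  have hp : p ≠ 0 := by
    rintro rfl
    simp at hdp
  refine lt_of_lt_of_le ?_ (le_weightedPartialTrace_rankOneSubScalar ha hd c hp hj)
  rw [div_mul_eq_mul_div, div_lt_iff₀ haj] at hcd
  linarith

theorem weightedPartialTrace_neg (a : Fin n → ℝ) (X : SymMat n) :
    weightedPartialTrace a (-X) = -weightedPartialTrace (a ∘ Fin.rev) X := by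
  simp only [weightedPartialTrace, SymMat.eig_neg, mul_neg, Finset.sum_neg_distrib]
  rw [← Equiv.sum_comp Fin.revPerm]
  simp

end WeightedPartialTrace

section HopfBarrier

variable {E : Type*} [NormedAddCommGroup E]

/-- The barrier `(L - ‖x - y‖²)²` for comparison on balls around points at distance less than `√L`
from `y`, where it decreases in `‖x - y‖`. It plays the role of the exponential in Hopf's lemma;
being a polynomial, it has an exact second order expansion. -/
def hopfBarrier (L : ℝ) (y x : E) : ℝ :=
  (L - ‖x - y‖ ^ 2) ^ 2

theorem continuous_hopfBarrier (L : ℝ) (y : E) : Continuous (hopfBarrier L y) := by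
  unfold hopfBarrier
  fun_prop

theorem norm_sub_le_of_hopfBarrier_le {L : ℝ} {x y z : E} (hz : ‖z - y‖ ^ 2 ≤ L)
    (hx : ‖x - y‖ ^ 2 ≤ L) (h : hopfBarrier L y z ≤ hopfBarrier L y x) : ‖x - y‖ ≤ ‖z - y‖ := by
  have hsq : L - ‖z - y‖ ^ 2 ≤ L - ‖x - y‖ ^ 2 :=
    (pow_le_pow_iff_left₀ (sub_nonneg.2 hz) (sub_nonneg.2 hx) two_ne_zero).1 h
  exact (pow_le_pow_iff_left₀ (norm_nonneg _) (norm_nonneg _) two_ne_zero).1 (by linarith)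

end HopfBarrier

section Jets

variable {n : ℕ} {Ω : Set (EuclideanSpace ℝ (Fin n))} {u : EuclideanSpace ℝ (Fin n) → ℝ}

theorem mem_subjet_of_isLocalMinOn_sub_hopfBarrier {x₁ y : EuclideanSpace ℝ (Fin n)} {L ε : ℝ}
    (h : IsLocalMinOn (fun x => u x - ε * hopfBarrier L y x) Ω x₁) :
    (-(4 * ε * (L - ‖x₁ - y‖ ^ 2)) • (x₁ - y),
      .rankOneSubScalar (8 * ε) (4 * ε * (L - ‖x₁ - y‖ ^ 2)) (x₁ - y)) ∈ subjet Ω u x₁ := by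
  refine ⟨fun x => (ε * (‖x - x₁‖ ^ 2 + 4 * inner ℝ (x₁ - y) (x - x₁))) * ‖x - x₁‖ ^ 2, ?_, ?_⟩
  · have htendsto : Tendsto (fun x => ε * (‖x - x₁‖ ^ 2 + 4 * inner ℝ (x₁ - y) (x - x₁)))
        (𝓝[Ω] x₁) (𝓝 0) := by
      have hcont : Continuous
          fun x => ε * (‖x - x₁‖ ^ 2 + 4 * inner ℝ (x₁ - y) (x - x₁)) := by fun_prop
      simpa using (hcont.tendsto x₁).mono_left nhdsWithin_le_nhds
    simpa only [one_mul] using ((isLittleO_one_iff ℝ).2 htendsto).mul_isBigO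
      (isBigO_refl (fun x => ‖x - x₁‖ ^ 2) (𝓝[Ω] x₁))
  · filter_upwards [h] with x hx
    have htouch : u x₁ + ε * (hopfBarrier L y x - hopfBarrier L y x₁) ≤ u x := by linarith
    refine le_of_eq_of_le ?_ htouch
    have hxy : x - y = (x₁ - y) + (x - x₁) := by abel
    rw [hopfBarrier, hopfBarrier, hxy, norm_add_sq_real, jetPolynomial,
      SymMat.inner_toEuclideanLin_rankOneSubScalar, real_inner_smul_left]
    ring

theorem exists_radius_mul_lt (K : ℝ) {r R : ℝ} (hr : 0 < r) (hR : 0 < R) :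
    ∃ ρ, 0 < ρ ∧ ρ < r ∧ ρ < R ∧ K * ((R + ρ) ^ 2 - (R - ρ) ^ 2) < 2 * (R - ρ) ^ 2 := by
  have hsmall : ∀ᶠ ρ in 𝓝[>] (0 : ℝ), K * ((R + ρ) ^ 2 - (R - ρ) ^ 2) < 2 * (R - ρ) ^ 2 := by
    have hleft : Continuous fun ρ : ℝ => K * ((R + ρ) ^ 2 - (R - ρ) ^ 2) := by fun_prop
    have hright : Continuous fun ρ : ℝ => 2 * (R - ρ) ^ 2 := by fun_prop
    have hzero : K * ((R + 0) ^ 2 - (R - 0) ^ 2) < 2 * (R - 0) ^ 2 := by simpa using pow_pos hR 2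
    exact ((hleft.tendsto 0).eventually_lt (hright.tendsto 0) hzero).filter_mono nhdsWithin_le_nhds
  obtain ⟨ρ, ⟨hρ₀, hρ⟩, hρK⟩ :=
    ((eventually_mem_set.2 (Ioo_mem_nhdsGT (lt_min hr hR))).and hsmall).exists
  exact ⟨ρ, hρ₀, hρ.trans_le (min_le_left _ _), hρ.trans_le (min_le_right _ _), hρK⟩

theorem exists_rankOneSubScalar_mem_subjet {K : ℝ} (hK : 0 ≤ K) (hΩ : IsOpen Ω)
    (hu : LowerSemicontinuousOn u Ω) {y z : EuclideanSpace ℝ (Fin n)} (hz : z ∈ Ω)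
    (hmin : IsMinOn u Ω z) (hyz : y ≠ z)
    (hball : ∀ x ∈ Ω, x ∈ closedBall y (dist z y) → x ≠ z → u z < u x) :
    ∃ x ∈ Ω, ∃ ξ p, ∃ d c : ℝ, 0 ≤ c ∧ K * c < d * ‖p‖ ^ 2 ∧
      (ξ, .rankOneSubScalar d c p) ∈ subjet Ω u x := by
  set R := ‖z - y‖ with hR
  obtain ⟨r, hr, hrΩ⟩ := Metric.isOpen_iff.1 hΩ z hz
  obtain ⟨ρ, hρ, hρr, hρR, hKρ⟩ :=
    exists_radius_mul_lt K hr (norm_pos_iff.2 (sub_ne_zero.2 hyz.symm))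
  have hρΩ : closedBall z ρ ⊆ Ω := (closedBall_subset_ball hρr).trans hrΩ
  have hannulus {x} (hx : x ∈ closedBall z ρ) : R - ρ ≤ ‖x - y‖ ∧ ‖x - y‖ ≤ R + ρ := by
    rw [mem_closedBall] at hx
    rw [hR, ← dist_eq_norm, ← dist_eq_norm]
    constructor <;> linarith [dist_triangle z x y, dist_triangle x z y, dist_comm x z]
  have hle {x} (hx : x ∈ closedBall z ρ) : ‖x - y‖ ^ 2 ≤ (R + ρ) ^ 2 :=
    pow_le_pow_left₀ (norm_nonneg _) (hannulus hx).2 2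
  have hz_mem : z ∈ closedBall z ρ := mem_closedBall_self hρ.le
  -- With `L = (R + ρ)²`, the largest value of `‖x - y‖²` on the ball, the barrier is decreasing in
  -- `‖x - y‖` there, so it is at least its value at `z` only where `u` is strictly larger.
  have hlt : ∀ x ∈ closedBall z ρ ∩ sphere z ρ,
      hopfBarrier ((R + ρ) ^ 2) y z ≤ hopfBarrier ((R + ρ) ^ 2) y x → u z < u x := by
    rintro x ⟨hx, hxρ⟩ hzx
    refine hball x (hρΩ hx) ?_ (ne_of_mem_sphere hxρ hρ.ne')
    simpa only [mem_closedBall, dist_eq_norm] using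
      norm_sub_le_of_hopfBarrier_le (hle hz_mem) (hle hx) hzx
  obtain ⟨ε, hε, x₁, ⟨hx₁, hx₁ρ⟩, hx₁min⟩ := exists_isMinOn_sub_mul_of_lt
    (isCompact_closedBall z ρ) isClosed_sphere (hu.mono hρΩ)
    (continuous_hopfBarrier ((R + ρ) ^ 2) y).continuousOn
    ⟨hz_mem, by simpa using hρ.ne⟩ (hmin.on_subset hρΩ) hlt
  have hx₁nhds : closedBall z ρ ∈ 𝓝[Ω] x₁ := mem_nhdsWithin_of_mem_nhds <|
    closedBall_mem_nhds_of_mem ((mem_closedBall.1 hx₁).lt_of_ne hx₁ρ)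
  refine ⟨x₁, hρΩ hx₁, _, _, _, _, mul_nonneg (by positivity) (sub_nonneg.2 (hle hx₁)), ?_,
    mem_subjet_of_isLocalMinOn_sub_hopfBarrier (mem_of_superset hx₁nhds hx₁min)⟩
  have hsq : (R - ρ) ^ 2 ≤ ‖x₁ - y‖ ^ 2 :=
    pow_le_pow_left₀ (sub_nonneg.2 hρR.le) (hannulus hx₁).1 2
  have hK₁ : K * ((R + ρ) ^ 2 - ‖x₁ - y‖ ^ 2) < 2 * ‖x₁ - y‖ ^ 2 :=
    calc K * ((R + ρ) ^ 2 - ‖x₁ - y‖ ^ 2)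
        ≤ K * ((R + ρ) ^ 2 - (R - ρ) ^ 2) := by gcongr
      _ < 2 * (R - ρ) ^ 2 := hKρ
      _ ≤ 2 * ‖x₁ - y‖ ^ 2 := by gcongr
  linarith [mul_lt_mul_of_pos_left hK₁ (mul_pos four_pos hε)]

theorem neg_mem_superjet_of_mem_subjet_neg {x ξ : EuclideanSpace ℝ (Fin n)} {X : SymMat n}
    (h : (ξ, X) ∈ subjet Ω (fun y => -u y) x) : (-ξ, -X) ∈ superjet Ω u x := by
  obtain ⟨r, hr, hle⟩ := h
  refine ⟨fun y => -r y, hr.neg_left, hle.mono fun y hy => ?_⟩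
  have hX : Matrix.toEuclideanLin (-X).1 = -Matrix.toEuclideanLin X.1 := map_neg _ X.1
  simp only [jetPolynomial, hX, LinearMap.neg_apply, inner_neg_left] at hy ⊢
  linarith

end Jets

section StrongMaximumPrinciple

variable {n : ℕ} {Ω : Set (EuclideanSpace ℝ (Fin n))} {u : EuclideanSpace ℝ (Fin n) → ℝ}
  {F : SymMat n → ℝ} {f : EuclideanSpace ℝ (Fin n) → ℝ}

theorem IsViscositySubsolution.neg (hu : IsViscositySubsolution F f Ω u) :
    IsViscositySupersolution (fun X => -F (-X)) (fun x => -f x) Ω (fun x => -u x) :=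
  ⟨fun x hx t ht => (hu.1 x hx (-t) (lt_neg.1 ht)).mono fun _ hy => lt_neg.1 hy,
    fun x hx _ hp => neg_le_neg (hu.2 x hx _ (neg_mem_superjet_of_mem_subjet_neg hp))⟩

theorem IsViscositySupersolution.eq_of_isMinOn (hu : IsViscositySupersolution F f Ω u)
    (hf : ∀ x ∈ Ω, f x ≤ 0) {K : ℝ} (hK : 0 ≤ K)
    (hF : ∀ (d c : ℝ) (p : EuclideanSpace ℝ (Fin n)), 0 ≤ c → K * c < d * ‖p‖ ^ 2 →
      0 < F (.rankOneSubScalar d c p))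
    (hΩ : IsOpen Ω) (hΩc : IsPreconnected Ω) {x₀ : EuclideanSpace ℝ (Fin n)} (hx₀ : x₀ ∈ Ω)
    (hmin : IsMinOn u Ω x₀) : ∀ x ∈ Ω, u x = u x₀ := by
  obtain ⟨v, hv, hAv⟩ := lowerSemicontinuousOn_iff_preimage_Iic.1 hu.1 (u x₀)
  set A := Ω ∩ u ⁻¹' Set.Iic (u x₀)
  suffices hΩA : Ω ⊆ A from fun x hx => le_antisymm (hΩA hx).2 (hmin hx)
  have hAclosed : closure A ∩ Ω ⊆ A := fun x ⟨hxA, hx⟩ =>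
    hAv ▸ ⟨hx, closure_minimal (hAv ▸ Set.inter_subset_right) hv hxA⟩
  by_contra hΩA
  obtain ⟨z, ⟨hz, hzle : u z ≤ u x₀⟩, y, hyz, hball⟩ := exists_closedBall_inter_eq_singleton hΩ hΩc
    Set.inter_subset_left hAclosed ⟨x₀, hx₀, le_refl (u x₀)⟩ hΩA
  have hzmin : IsMinOn u Ω z := fun x hx => hzle.trans (hmin hx)
  obtain ⟨x, hx, ξ, p, d, c, hc, hcd, hjet⟩ := exists_rankOneSubScalar_mem_subjet hK hΩ hu.1 hz
    hzmin hyz fun x hx hxy hxz => lt_of_not_ge fun hxz' => hxz <|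
      hball.subset ⟨hxy, hx, hxz'.trans hzle⟩
  exact ((hu.2 x hx _ hjet).trans (hf x hx)).not_gt (hF d c p hc hcd)

variable {a : Fin n → ℝ}

theorem eq_of_isMinOn_of_isViscositySupersolution_weightedPartialTrace (ha : ∀ i, 0 ≤ a i)
    {j : Fin n} (hj : IsTop j) (haj : 0 < a j) (hf : ∀ x ∈ Ω, f x ≤ 0)
    (hu : IsViscositySupersolution (weightedPartialTrace a) f Ω u)
    (hΩ : IsOpen Ω) (hΩc : IsPreconnected Ω) {x₀ : EuclideanSpace ℝ (Fin n)} (hx₀ : x₀ ∈ Ω)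
    (hmin : IsMinOn u Ω x₀) : ∀ x ∈ Ω, u x = u x₀ :=
  hu.eq_of_isMinOn hf (div_nonneg (Finset.sum_nonneg fun i _ => ha i) haj.le)
    (fun _ _ _ hc hcd => weightedPartialTrace_rankOneSubScalar_pos ha hj haj hc hcd)
    hΩ hΩc hx₀ hmin

theorem eq_of_isMaxOn_of_isViscositySubsolution_weightedPartialTrace (ha : ∀ i, 0 ≤ a i)
    {j : Fin n} (hj : IsBot j) (haj : 0 < a j) (hf : ∀ x ∈ Ω, 0 ≤ f x)
    (hu : IsViscositySubsolution (weightedPartialTrace a) f Ω u)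
    (hΩ : IsOpen Ω) (hΩc : IsPreconnected Ω) {x₀ : EuclideanSpace ℝ (Fin n)} (hx₀ : x₀ ∈ Ω)
    (hmax : IsMaxOn u Ω x₀) : ∀ x ∈ Ω, u x = u x₀ := by
  have hneg : IsViscositySupersolution (weightedPartialTrace (a ∘ Fin.rev)) (fun x => -f x) Ω
      fun x => -u x := by
    simpa only [weightedPartialTrace_neg, neg_neg] using hu.neg
  have hrev : IsTop j.rev := fun i => Fin.le_rev_iff.2 (hj i.rev)
  intro x hx
  exact neg_injective <| eq_of_isMinOn_of_isViscositySupersolution_weightedPartialTrace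
    (fun i => ha i.rev) hrev (by simpa using haj) (fun x hx => neg_nonpos.2 (hf x hx)) hneg
    hΩ hΩc hx₀ hmax.neg x hx

end StrongMaximumPrinciple

theorem mainTheorem10_general (n : ℕ) (hn : 1 ≤ n) (a : Fin n → ℝ) (ha : ∀ i, 0 ≤ a i)
    (Ω : Set (EuclideanSpace ℝ (Fin n))) (hΩ : IsOpen Ω) (hΩc : IsPreconnected Ω) :
    (0 < a ⟨n - 1, Nat.sub_one_lt_of_lt hn⟩ →
      ∀ u : EuclideanSpace ℝ (Fin n) → ℝ,
        IsViscositySupersolution (weightedPartialTrace a) (fun _ => 0) Ω u →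
        ∀ x₀ ∈ Ω, IsMinOn u Ω x₀ → ∀ x ∈ Ω, u x = u x₀) ∧
    (0 < a ⟨0, hn⟩ →
      ∀ u : EuclideanSpace ℝ (Fin n) → ℝ,
        IsViscositySubsolution (weightedPartialTrace a) (fun _ => 0) Ω u →
        ∀ x₀ ∈ Ω, IsMaxOn u Ω x₀ → ∀ x ∈ Ω, u x = u x₀) := by
  have hlast_top : IsTop (⟨n - 1, Nat.sub_one_lt_of_lt hn⟩ : Fin n) := fun i =>
    Nat.le_sub_one_of_lt i.2
  have hfirst_bot : IsBot (⟨0, hn⟩ : Fin n) := fun i => Nat.zero_le i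
  refine ⟨fun hlast u hu x₀ hx₀ hmin => ?_, fun hfirst u hu x₀ hx₀ hmax => ?_⟩
  · exact eq_of_isMinOn_of_isViscositySupersolution_weightedPartialTrace ha hlast_top hlast
      (fun _ _ => le_rfl) hu hΩ hΩc hx₀ hmin
  · exact eq_of_isMaxOn_of_isViscositySubsolution_weightedPartialTrace ha hfirst_bot hfirst
      (fun _ _ => le_rfl) hu hΩ hΩc hx₀ hmax

theorem mainTheorem10 (n : ℕ) (hn : 1 ≤ n) (a : Fin n → ℝ) (ha : ∀ i, 0 ≤ a i)
    (Ω : Set (EuclideanSpace ℝ (Fin n))) (hΩ : IsOpen Ω) (hΩc : IsConnected Ω) :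
    (0 < a ⟨n - 1, Nat.sub_one_lt_of_lt hn⟩ →
      ∀ u : EuclideanSpace ℝ (Fin n) → ℝ, ContinuousOn u Ω → (∀ x ∈ Ω, 0 ≤ u x) →
        IsViscositySupersolution (weightedPartialTrace a) (fun _ => 0) Ω u →
        ∀ x₀ ∈ Ω, IsMinOn u Ω x₀ → ∀ x ∈ Ω, u x = u x₀) ∧
    (0 < a ⟨0, hn⟩ →
      ∀ u : EuclideanSpace ℝ (Fin n) → ℝ, ContinuousOn u Ω →
        IsViscositySubsolution (weightedPartialTrace a) (fun _ => 0) Ω u →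
        ∀ x₀ ∈ Ω, IsMaxOn u Ω x₀ → ∀ x ∈ Ω, u x = u x₀) := by
  obtain ⟨hmin, hmax⟩ := mainTheorem10_general n hn a ha Ω hΩ hΩc.isPreconnected
  exact ⟨fun hlast u _ _ => hmin hlast u, fun hfirst u _ => hmax hfirst u⟩
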